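/- Let $p$ be a prime, let $k$ be a field of characteristic $p$ that is $F$-finite (i.e. $[k:k^p]<\infty$), let $n\ge 0$, $S=k[[x_1,\dots,x_n]]$ and $t\in\mathbb R_{>0}$. Let $\mathfrak a\subseteq S$ be a monomial ideal, i.e. an ideal generated by monomials $x^u=x_1^{u_1}\cdots x_n^{u_n}$, and let $\mathbf P_{\mathfrak a}\subseteq\mathbb R^n$ be its Newton polyhedron, the closed convex hull of $\{u\in\mathbb Z_{\ge 0}^n : x^u\in\mathfrak a\}$. Definitions. For a local ring $(R,\mathfrak m)$ of characteristic $p$, with residue field $\kappa$, and $e\ge 0$, let $F^e_*R$ be the additive group of $R$ with the $R$-module structure $r\cdot F^e_*x=F^e_*(r^{p^e}x)$, and let $\mathcal C_e=\operatorname{Hom}_R(F^e_*R,R)$; the product of $\varphi\in\mathcal C_{e_1}$ and $\psi\in\mathcal C_{e_2}$ is $\varphi\circ F^{e_1}_*\psi\in\mathcal C_{e_1+e_2}$. A Cartier subalgebra on $R$ is a family $\mathcal D$ of additive subgroups $\mathcal D_e\subseteq\mathcal C_e$ $(e\ge 0)$, closed under this product, with $\mathcal D_0=\mathcal C_0$ and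 $\mathcal D_e\ne 0$ for some $e>0$. In a direct sum decomposition $F^e_*R=\bigoplus_i M_i$ of $R$-modules, $M_j$ is a $\mathcal D$-summand if, for some isomorphism $M_j\cong R$, the projection $F^e_*R\to M_j\cong R$ lies in $\mathcal D_e$; the $F$-splitting number $a_e^{\mathcal D}$ is the maximal number of $\mathcal D$-summands in such a decomposition. Put $\alpha(R)=\log_p[\kappa:\kappa^p]$ and $\Gamma_{\mathcal D}=\{e\ge 0: a_e^{\mathcal D}\ne 0\}$. The $F$-signature is $$s(R,\mathcal D)=\lim_{e\in\Gamma_{\mathcal D},\ e\to\infty}\frac{a_e^{\mathcal D}}{p^{e(\dim R+\alpha(R))}},$$ and it is $0$ if $\Gamma_{\mathcal D}$ is finite. Let $\mathcal D=\mathcal C^{\mathfrak a^t}$ be the family with $\mathcal D_e=\mathcal C_e\cdot F^e_*\mathfrak a^{\lceil t(p^e-1)\rceil}$, the subgroup of $\mathcal C_e=\operatorname{Hom}_S(F^e_*S,S)$ generated by all maps $\varphi(F^e_*b\cdot{-})$ with $\varphi\in\mathcal C_e$ and $b\in\mathfrak a^{\lceil t(p^e-1)\rceil}$, and write $s(S,\mathfrak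 a^t)=s(S,\mathcal C^{\mathfrak a^t})$. Theorem. If $\mathfrak a\neq 0$, then $\mathcal C^{\mathfrak a^t}$ is a Cartier subalgebra on $S$. The limit defining $s(S,\mathfrak a^t)$ exists, and $$s(S,\mathfrak a^t)=\operatorname{vol}_{\mathbb R^n}\bigl(t\,\mathbf P_{\mathfrak a}\cap[0,1]^n\bigr),$$ the Euclidean volume of the intersection of $t\,\mathbf P_{\mathfrak a}$ with the unit cube. (For $\mathfrak a=0$ both sides are $0$.) In particular, for a given set of exponents of monomials generating $\mathfrak a$, the value depends neither on $k$ nor on $p$. -/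

import Mathlib

open Filter Topology MeasureTheory
open scoped Pointwise

noncomputable section

/-- `FPush p e R` is the `R`-module `F^e_* R`: the additive group of `R`, on which `r` acts as
multiplication by `r ^ (p ^ e)`. -/
def FPush (_p _e : ℕ) (R : Type*) : Type _ := R

namespace FPush

variable (p e : ℕ) (R : Type*) [CommRing R]

instance : AddCommGroup (FPush p e R) := inferInstanceAs (AddCommGroup R)

instance [Fact p.Prime] [CharP R p] : Module R (FPush p e R) :=
  letI : Module R (FPush p e R) := inferInstanceAs (Module R R)
  Module.compHom (FPush p e R) (iterateFrobenius R p e)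

/-- The bijection `x ↦ F^e_* x` from `R` to `F^e_* R`. -/
def of : R ≃+ FPush p e R := AddEquiv.refl R

variable {R}

theorem smul_of [Fact p.Prime] [CharP R p] (r x : R) :
    r • of p e R x = of p e R (r ^ p ^ e * x) := rfl

variable [Fact p.Prime] [CharP R p]

/-- Multiplication by `F^e_* b`, as an `R`-linear endomorphism of `F^e_* R`. -/
def mulMap (b : R) : FPush p e R →ₗ[R] FPush p e R where
  toFun x := of p e R (b * (of p e R).symm x)
  map_add' x y := by simp [mul_add]
  map_smul' r x := by
    obtain ⟨x, rfl⟩ := (of p e R).surjective x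
    simp only [smul_of, AddEquiv.symm_apply_apply, RingHom.id_apply]
    congr 1
    ring

end FPush

section Cartier

variable (p : ℕ) [Fact p.Prime] (R : Type*) [CommRing R] [CharP R p]

/-- The group `𝒞_e = Hom_R(F^e_* R, R)` of `p^{-e}`-linear maps on `R`. -/
abbrev CartierMap (e : ℕ) : Type _ := FPush p e R →ₗ[R] R

variable {R}

/-- The product of `φ ∈ 𝒞_{e₁}` and `ψ ∈ 𝒞_{e₂}` in the Cartier algebra, namely
`φ ∘ F^{e₁}_* ψ ∈ 𝒞_{e₁ + e₂}`: as additive maps on `R` this is the composition. -/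
def cartierMul {e₁ e₂ : ℕ} (φ : CartierMap p R e₁) (ψ : CartierMap p R e₂) :
    CartierMap p R (e₁ + e₂) where
  toFun x := φ (FPush.of p e₁ R (ψ (FPush.of p e₂ R ((FPush.of p (e₁ + e₂) R).symm x))))
  map_add' x y := by simp
  map_smul' r x := by
    obtain ⟨x, rfl⟩ := (FPush.of p (e₁ + e₂) R).surjective x
    rw [FPush.smul_of, AddEquiv.symm_apply_apply, AddEquiv.symm_apply_apply, pow_add, pow_mul,
      ← FPush.smul_of, map_smul, smul_eq_mul, ← FPush.smul_of, map_smul, RingHom.id_apply]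

/-- A graded family of additive subgroups `𝒟_e ⊆ 𝒞_e` is a Cartier subalgebra on `R` if
`𝒟_0 = 𝒞_0`, it is closed under the multiplication of the Cartier algebra, and `𝒟_e ≠ 0` for some
`e > 0`. (An additive subgroup is automatically an `𝔽_p`-subspace.) -/
structure IsCartierSubalgebra (D : ∀ e, AddSubgroup (CartierMap p R e)) : Prop where
  zero_eq_top : D 0 = ⊤
  mul_mem : ∀ {e₁ e₂ : ℕ} {φ : CartierMap p R e₁} {ψ : CartierMap p R e₂},
    φ ∈ D e₁ → ψ ∈ D e₂ → cartierMul p φ ψ ∈ D (e₁ + e₂)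
  exists_ne_bot : ∃ e, 0 < e ∧ D e ≠ ⊥

/-- The subgroup `𝒞_e · F^e_* I` of `𝒞_e`, generated by the maps `φ(F^e_* b · _)` with `φ ∈ 𝒞_e`
and `b ∈ I`. -/
def cartierMulIdeal (e : ℕ) (I : Ideal R) : AddSubgroup (CartierMap p R e) :=
  AddSubgroup.closure {χ | ∃ φ : CartierMap p R e, ∃ b ∈ I, χ = φ ∘ₗ FPush.mulMap p e b}

/-- The Cartier algebra `𝒞^{𝔞^t}` of the pair `(R, 𝔞^t)`, whose degree `e` part is
`𝒞_e · F^e_* 𝔞^{⌈t(p^e - 1)⌉}`. -/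
def pairCartier (𝔞 : Ideal R) (t : ℝ) (e : ℕ) : AddSubgroup (CartierMap p R e) :=
  cartierMulIdeal p e (𝔞 ^ ⌈t * ((p : ℝ) ^ e - 1)⌉₊)

/-- In an internal direct sum decomposition `F^e_* R = ⨁ M_i`, the summand `M_j` is a
`𝒟`-summand if there is an isomorphism `M_j ≃ R` for which the composite
`F^e_* R → M_j ≃ R` with the projection belongs to `𝒟_e`. -/
def IsDSummand {e : ℕ} (De : AddSubgroup (CartierMap p R e)) {m : ℕ}
    (M : Fin m → Submodule R (FPush p e R)) (hM : DirectSum.IsInternal M) (j : Fin m) : Prop :=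
  ∃ f : M j ≃ₗ[R] R,
    f.toLinearMap ∘ₗ DirectSum.component R (Fin m) (fun i => M i) j ∘ₗ
      (LinearEquiv.ofBijective (DirectSum.coeLinearMap M) hM).symm.toLinearMap ∈ De

/-- The `e`-th `F`-splitting number `a_e^𝒟`: the maximal number of `𝒟`-summands in a direct sum
decomposition of `F^e_* R` as an `R`-module. -/
def splittingNumber {e : ℕ} (De : AddSubgroup (CartierMap p R e)) : ℕ :=
  sSup {N | ∃ (m : ℕ) (M : Fin m → Submodule R (FPush p e R)) (hM : DirectSum.IsInternal M),
    N = Nat.card {j : Fin m // IsDSummand p De M hM j}}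

/-- The semigroup `Γ_𝒟 = {e ≥ 0 | a_e^𝒟 ≠ 0}`. -/
def splittingSemigroup (D : ∀ e, AddSubgroup (CartierMap p R e)) : Set ℕ :=
  {e | splittingNumber p (D e) ≠ 0}

end Cartier

/-- A ring of characteristic `p` is `F`-finite if `F_* R` is a finitely generated `R`-module. -/
def IsFFinite (p : ℕ) [Fact p.Prime] (R : Type*) [CommRing R] [CharP R p] : Prop :=
  Module.Finite R (FPush p 1 R)

instance residueField_charP (p : ℕ) [hp : Fact p.Prime] (R : Type*) [CommRing R] [CharP R p]
    [IsLocalRing R] : CharP (IsLocalRing.ResidueField R) p :=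
  (CharP.charP_iff_prime_eq_zero hp.out).mpr (by
    rw [← map_natCast (IsLocalRing.residue R) p, CharP.cast_eq_zero, map_zero])

instance mvPowerSeries_charP (p : ℕ) (σ k : Type*) [CommRing k] [CharP k p] :
    CharP (MvPowerSeries σ k) p :=
  charP_of_injective_ringHom (f := (MvPowerSeries.C : k →+* MvPowerSeries σ k))
    (fun a b h => by simpa using congrArg MvPowerSeries.constantCoeff h) p

/-- `α(R) = log_p [k : k^p]`, where `k` is the residue field of `R`. -/
def alphaInv (p : ℕ) [Fact p.Prime] (R : Type*) [CommRing R] [CharP R p] [IsLocalRing R] : ℝ :=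
  Real.logb p (Module.finrank (frobenius (IsLocalRing.ResidueField R) p).fieldRange
    (IsLocalRing.ResidueField R))

/-- The Krull dimension as a natural number (for rings of finite Krull dimension). -/
def krullDimNat (R : Type*) [CommRing R] : ℕ := ((ringKrullDim R).unbotD 0).toNat

/-- `HasFSignature p D s` says that the `F`-signature `s(R, 𝒟)` of the local ring `R` exists and
equals `s`: the quotients `a_e^𝒟 / p^{e (d + α(R))}`, with `d = dim R`, converge to `s` as
`e ∈ Γ_𝒟` tends to infinity. If there are only finitely many `e` with `a_e^𝒟 ≠ 0`, then the
`F`-signature is `0` by convention (this is then the limit of the quotients over all `e`). -/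
structure HasFSignature (p : ℕ) [Fact p.Prime] {R : Type*} [CommRing R] [CharP R p]
    [IsLocalRing R] (D : ∀ e, AddSubgroup (CartierMap p R e)) (s : ℝ) : Prop where
  tendsto : Tendsto
    (fun e : ℕ => (splittingNumber p (D e) : ℝ) /
      (p : ℝ) ^ ((e : ℝ) * ((krullDimNat R : ℝ) + alphaInv p R)))
    (atTop ⊓ 𝓟 (splittingSemigroup p D)) (𝓝 s)
  eq_zero_of_finite : (splittingSemigroup p D).Finite → s = 0

section Monomial

variable {n : ℕ} {k : Type*} [Field k]

/-- A monomial ideal of `k⟦x_1, …, x_n⟧` is an ideal generated by a set of monomials `x^u`. -/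
def IsMonomialIdeal (𝔞 : Ideal (MvPowerSeries (Fin n) k)) : Prop :=
  ∃ A : Set (Fin n →₀ ℕ), 𝔞 = Ideal.span ((fun u => MvPowerSeries.monomial u (1 : k)) '' A)

/-- The Newton polyhedron of `𝔞`: the closed convex hull in `ℝ^n` of the exponents `u` of the
monomials `x^u ∈ 𝔞`. -/
def newtonPolyhedron (𝔞 : Ideal (MvPowerSeries (Fin n) k)) : Set (Fin n → ℝ) :=
  closedConvexHull ℝ
    {v | ∃ u : Fin n →₀ ℕ, MvPowerSeries.monomial u (1 : k) ∈ 𝔞 ∧ v = fun i => (u i : ℝ)}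

end Monomial

end

/-!
Let `q = p^e`. If `λ` is a `k`-basis of `F^e_* k`, then the elements `F^e_*(λ_j x^u)` with
`0 ≤ u_i < q` form an `S`-basis of `F^e_* S`. The coordinate of `λ_j x^u` is the coordinate of
`λ_j x^(q-1)` precomposed with multiplication by `x^(q-1-u)`, so it lies in `𝒞_e · F^e_* I` as soon
as `x^(q-1-u) ∈ I`; when `I` is monomial and `x^(q-1-u) ∉ I`, every map in `𝒞_e · F^e_* I` sends
`λ_j x^u` into the maximal ideal. Comparing ranks modulo the maximal ideal, the splitting number is
`[F^e_* k : k]` times the number of `w ∈ [0, q-1]^n` with `x^w ∈ I`. As `S` has dimension `n`, the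
factor `[F^e_* k : k] = p^(eα)` cancels, and `q^n` is left in the denominator.

For `I = 𝔞^N`, all these exponents lie in `N P_𝔞`. Conversely every lattice point of
`(N + n + 1) P_𝔞` is such an exponent: by Carathéodory it is, up to a small error, a combination of
at most `n + 1` exponents of `𝔞`, and rounding its coefficients down loses less than `n + 1` in
total. With `N = ⌈t(q-1)⌉` the count is therefore, up to `O(q^(n-1))`, squeezed between numbers of
lattice points of two dilates of `t P_𝔞 ∩ [0,1]^n` whose scaling factors differ by a constant.
-/

noncomputable section

section LatticePoints

variable {ι : Type*}

/-- An exponent `u ∈ ℕ^ι`, as a vector in `ℝ^ι`. -/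
def exponentVector (ι : Type*) : (ι →₀ ℕ) →+ (ι → ℝ) where
  toFun u i := u i
  map_zero' := by ext; simp
  map_add' u v := by ext; simp

@[simp]
theorem exponentVector_apply (u : ι →₀ ℕ) (i : ι) : exponentVector ι u i = u i := rfl

theorem exponentVector_injective : Function.Injective (exponentVector ι) := fun _ _ h =>
  Finsupp.ext fun i => Nat.cast_injective (congrFun h i)

theorem mem_range_exponentVector_iff [Finite ι] {x : ι → ℝ} (hx : 0 ≤ x) :
    x ∈ Set.range (exponentVector ι) ↔
      x ∈ Submodule.span ℤ (Set.range (Pi.basisFun ℝ ι)) := by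
  rw [Module.Basis.mem_span_iff_repr_mem]
  refine ⟨?_, fun h => ?_⟩
  · rintro ⟨u, rfl⟩ i
    exact ⟨u i, by simp⟩
  · choose z hz using h
    have hz' : ∀ i, (z i : ℝ) = x i := fun i => by simpa using hz i
    refine ⟨Finsupp.equivFunOnFinite.symm fun i => (z i).toNat, funext fun i => ?_⟩
    have hzi : 0 ≤ z i := Int.cast_nonneg_iff.mp ((hx i).trans_eq (hz' i).symm)
    rw [exponentVector_apply, Finsupp.equivFunOnFinite_symm_apply_apply, ← hz', ← Int.cast_natCast,
      Int.toNat_of_nonneg hzi]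

/-- The exponents of the monomials whose degree in each variable is less than `q`. -/
def exponentCube (ι : Type*) (q : ℕ) : Set (ι →₀ ℕ) := {w | ∀ i, w i < q}

theorem exponentCube_mono {a b : ℕ} (h : a ≤ b) : exponentCube ι a ⊆ exponentCube ι b :=
  fun _ hw i => (hw i).trans_le h

theorem preimage_smul_subset_exponentCube {X : Set (ι → ℝ)} (hX : X ⊆ Set.Icc 0 1) (m : ℕ) :
    exponentVector ι ⁻¹' ((m : ℝ) • X) ⊆ exponentCube ι (m + 1) := by
  rintro w ⟨x, hx, hxw⟩ i
  have hwi : (w i : ℝ) = m * x i := (congrFun hxw i).symm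
  have : (w i : ℝ) ≤ m := hwi ▸ mul_le_of_le_one_right (Nat.cast_nonneg m) ((hX hx).2 i)
  exact Nat.lt_succ_of_le (by exact_mod_cast this)

theorem exponentCube_eq_image [Fintype ι] [DecidableEq ι] (q : ℕ) : exponentCube ι q =
    Finsupp.equivFunOnFinite.symm '' ↑(Fintype.piFinset fun _ : ι => Finset.range q) := by
  ext w
  simp [exponentCube]

theorem finite_exponentCube [Finite ι] (q : ℕ) : (exponentCube ι q).Finite := by
  classical
  cases nonempty_fintype ι
  exact exponentCube_eq_image (ι := ι) q ▸ (Finset.finite_toSet _).image _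

variable [Fintype ι]

theorem ncard_exponentCube (q : ℕ) : (exponentCube ι q).ncard = q ^ Fintype.card ι := by
  classical
  rw [exponentCube_eq_image, Set.ncard_image_of_injective _ (Equiv.injective _),
    Set.ncard_coe_finset, Fintype.card_piFinset, Finset.card_range, Finset.prod_const,
    Finset.card_univ]

theorem tendsto_ncard_lattice_points_div_pow {X : Set (ι → ℝ)} (hX : Bornology.IsBounded X)
    (hX₀ : X ⊆ Set.Ici 0) (hmeas : MeasurableSet X) (hfr : volume (frontier X) = 0) :
    Tendsto (fun m : ℕ => ((exponentVector ι ⁻¹' ((m : ℝ) • X)).ncard : ℝ) /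
      (m : ℝ) ^ Fintype.card ι) atTop (𝓝 (volume.real X)) := by
  refine (tendsto_card_div_pow_atTop_volume X hX hmeas hfr).congr' ?_
  filter_upwards [eventually_gt_atTop 0] with m hm
  have hm' : (m : ℝ) ≠ 0 := by positivity
  congr 2
  rw [← Set.ncard_image_of_injective _ exponentVector_injective, Nat.card_coe_set_eq,
    Set.image_preimage_eq_inter_range,
    ← Set.ncard_image_of_injective _ (smul_right_injective _ hm')]
  congr 1
  rw [Set.image_smul, Set.smul_set_inter₀ hm', smul_inv_smul₀ hm']
  ext x
  refine and_congr_right fun hx => (mem_range_exponentVector_iff ?_).symm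
  obtain ⟨y, hy, rfl⟩ := hx
  exact smul_nonneg (Nat.cast_nonneg m) (hX₀ hy)

theorem tendsto_shift_div_shift_pow {f : ℕ → ℝ} {n : ℕ} {V : ℝ}
    (hf : Tendsto (fun m : ℕ => f m / (m : ℝ) ^ n) atTop (𝓝 V)) (a b : ℕ) :
    Tendsto (fun m : ℕ => f (m + a) / ((m : ℝ) + b) ^ n) atTop (𝓝 V) := by
  have hratio : Tendsto (fun m : ℕ => (((m : ℝ) + a) / ((m : ℝ) + b)) ^ n) atTop (𝓝 1) := by
    simpa [add_comm] using
      (tendsto_add_mul_div_add_mul_atTop_nhds (a : ℝ) b 1 one_ne_zero).pow n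
  have hprod := ((tendsto_add_atTop_iff_nat a).mpr hf).mul hratio
  rw [mul_one] at hprod
  refine hprod.congr' ?_
  filter_upwards [eventually_gt_atTop 0] with m hm
  have : ((m : ℝ) + a) ≠ 0 := by positivity
  rw [div_pow, Nat.cast_add, div_mul_div_cancel₀ (pow_ne_zero n this)]

theorem ncard_sub_le_of_inter_exponentCube_subset {L G : Set (ι →₀ ℕ)} {a b : ℕ} (hab : a ≤ b)
    (hL : L ⊆ exponentCube ι b) (hG : G.Finite) (hLG : L ∩ exponentCube ι a ⊆ G) :
    (L.ncard : ℝ) - ((b : ℝ) ^ Fintype.card ι - (a : ℝ) ^ Fintype.card ι) ≤ G.ncard := by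
  have hsub : L ⊆ G ∪ exponentCube ι b \ exponentCube ι a := fun w hw =>
    or_iff_not_imp_right.mpr fun h => hLG ⟨hw, not_not.mp fun hn => h ⟨hL hw, hn⟩⟩
  have hcard := (Set.ncard_le_ncard hsub (hG.union (finite_exponentCube b).sdiff)).trans
    (Set.ncard_union_le _ _)
  have hdiff := Set.ncard_sdiff_add_ncard_of_subset (exponentCube_mono (ι := ι) hab)
    (finite_exponentCube b)
  rw [ncard_exponentCube, ncard_exponentCube] at hdiff
  have hcard' : (L.ncard : ℝ) ≤ G.ncard + (exponentCube ι b \ exponentCube ι a).ncard := by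
    exact_mod_cast hcard
  have hdiff' : ((exponentCube ι b \ exponentCube ι a).ncard : ℝ) + (a : ℝ) ^ Fintype.card ι =
      (b : ℝ) ^ Fintype.card ι := by exact_mod_cast hdiff
  linarith

theorem tendsto_pow_sub_pow_div_shift_pow (n a b c : ℕ) :
    Tendsto (fun m : ℕ => (((m + a : ℕ) : ℝ) ^ n - ((m + b : ℕ) : ℝ) ^ n) / ((m : ℝ) + c) ^ n)
      atTop (𝓝 0) := by
  have hone : Tendsto (fun m : ℕ => (m : ℝ) ^ n / (m : ℝ) ^ n) atTop (𝓝 1) := by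
    refine tendsto_const_nhds.congr' ?_
    filter_upwards [eventually_gt_atTop 0] with m hm
    rw [div_self (by positivity)]
  simpa only [sub_div, sub_self] using
    (tendsto_shift_div_shift_pow hone a c).sub (tendsto_shift_div_shift_pow hone b c)

theorem tendsto_ncard_div_pow_of_lattice_points_subset {X : Set (ι → ℝ)} (hX : X ⊆ Set.Icc 0 1)
    (hmeas : MeasurableSet X) (hfr : volume (frontier X) = 0) {G : ℕ → Set (ι →₀ ℕ)} (d : ℕ)
    (hG : ∀ m > 0, G m ⊆ exponentVector ι ⁻¹' ((m : ℝ) • X))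
    (hG' : ∀ m > 0, exponentVector ι ⁻¹' (((m + d : ℕ) : ℝ) • X) ∩ exponentCube ι (m + 1) ⊆ G m) :
    Tendsto (fun m : ℕ => ((G m).ncard : ℝ) / ((m : ℝ) + 1) ^ Fintype.card ι) atTop
      (𝓝 (volume.real X)) := by
  let L (m : ℕ) : Set (ι →₀ ℕ) := exponentVector ι ⁻¹' ((m : ℝ) • X)
  have hLcube (m : ℕ) : L m ⊆ exponentCube ι (m + 1) := preimage_smul_subset_exponentCube hX m
  have hLfin (m : ℕ) : (L m).Finite := (finite_exponentCube (m + 1)).subset (hLcube m)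
  have hL : Tendsto (fun m : ℕ => ((L m).ncard : ℝ) / (m : ℝ) ^ Fintype.card ι) atTop
      (𝓝 (volume.real X)) :=
    tendsto_ncard_lattice_points_div_pow ((Metric.isBounded_Icc _ _).subset hX)
      (fun x hx => (hX hx).1) hmeas hfr
  have hupper : Tendsto (fun m : ℕ => ((L m).ncard : ℝ) / ((m : ℝ) + 1) ^ Fintype.card ι) atTop
      (𝓝 (volume.real X)) := by
    simpa only [add_zero, Nat.cast_one] using tendsto_shift_div_shift_pow hL 0 1
  have hlower : Tendsto (fun m : ℕ => (((L (m + d)).ncard : ℝ) -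
      (((m + d + 1 : ℕ) : ℝ) ^ Fintype.card ι - ((m + 1 : ℕ) : ℝ) ^ Fintype.card ι)) /
        ((m : ℝ) + 1) ^ Fintype.card ι) atTop (𝓝 (volume.real X)) := by
    simpa only [sub_div, sub_zero, Nat.cast_one, add_assoc] using
      (tendsto_shift_div_shift_pow hL d 1).sub
        (tendsto_pow_sub_pow_div_shift_pow (Fintype.card ι) (d + 1) 1 1)
  refine tendsto_of_tendsto_of_tendsto_of_le_of_le' hlower hupper ?_ ?_
  · filter_upwards [eventually_gt_atTop 0] with m hm
    gcongr
    exact ncard_sub_le_of_inter_exponentCube_subset (by omega) (hLcube _)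
      ((hLfin m).subset (hG m hm)) (hG' m hm)
  · filter_upwards [eventually_gt_atTop 0] with m hm
    gcongr
    exacts [hLfin m, hG m hm]

end LatticePoints

section Exponents

variable {σ k : Type*} [CommRing k]

/-- The exponents `u` of the monomials `x^u` lying in an ideal of `k⟦x⟧`. -/
def exponents (I : Ideal (MvPowerSeries σ k)) : Set (σ →₀ ℕ) :=
  {u | MvPowerSeries.monomial u (1 : k) ∈ I}

theorem mem_exponents {I : Ideal (MvPowerSeries σ k)} {u : σ →₀ ℕ} :
    u ∈ exponents I ↔ MvPowerSeries.monomial u (1 : k) ∈ I := Iff.rfl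

theorem isUpperSet_exponents (I : Ideal (MvPowerSeries σ k)) : IsUpperSet (exponents I) := by
  intro v w hvw hv
  rw [mem_exponents, ← tsub_add_cancel_of_le hvw, ← one_mul (1 : k),
    ← MvPowerSeries.monomial_mul_monomial]
  exact I.mul_mem_left _ hv

theorem nsmul_exponents_subset (I : Ideal (MvPowerSeries σ k)) (N : ℕ) :
    N • exponents I ⊆ exponents (I ^ N) := by
  induction N with
  | zero => simp [mem_exponents, Set.subset_def]
  | succ N ih =>
    rw [succ_nsmul, pow_succ]
    rintro _ ⟨a, ha, b, hb, rfl⟩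
    rw [mem_exponents, ← one_mul (1 : k), ← MvPowerSeries.monomial_mul_monomial]
    exact Ideal.mul_mem_mul (ih ha) hb

theorem exists_le_of_mem_span_monomial {A : Set (σ →₀ ℕ)} {f : MvPowerSeries σ k}
    (hf : f ∈ Ideal.span ((fun u => MvPowerSeries.monomial u (1 : k)) '' A)) {w : σ →₀ ℕ}
    (hw : MvPowerSeries.coeff w f ≠ 0) : ∃ v ∈ A, v ≤ w := by
  classical
  by_contra! hA
  refine hw ?_
  clear hw
  induction hf using Submodule.span_induction generalizing w with
  | mem x hx =>
    obtain ⟨v, hv, rfl⟩ := hx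
    exact MvPowerSeries.coeff_monomial_ne (fun h => hA v hv h.ge) 1
  | zero => exact map_zero _
  | add x y _ _ ihx ihy => rw [map_add, ihx hA, ihy hA, add_zero]
  | smul a x _ ih =>
    rw [smul_eq_mul, MvPowerSeries.coeff_mul]
    refine Finset.sum_eq_zero fun ij hij => ?_
    have hle : ij.2 ≤ w := Finset.HasAntidiagonal.mem_antidiagonal.mp hij ▸ le_add_self
    rw [ih fun v hv hv' => hA v hv (hv'.trans hle), mul_zero]

theorem span_monomial_pow (A : Set (σ →₀ ℕ)) (N : ℕ) :
    Ideal.span ((fun u => MvPowerSeries.monomial u (1 : k)) '' A) ^ N =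
      Ideal.span ((fun u => MvPowerSeries.monomial u (1 : k)) '' (N • A)) := by
  induction N with
  | zero => simp [MvPowerSeries.monomial_zero_one]
  | succ N ih =>
    rw [pow_succ, ih, Ideal.span_mul_span', succ_nsmul, ← Set.image2_mul, ← Set.image2_add,
      Set.image2_image_left, Set.image2_image_right, Set.image_image2]
    simp only [MvPowerSeries.monomial_mul_monomial, one_mul]

end Exponents

namespace IsMonomialIdeal

variable {n : ℕ} {k : Type*} [Field k] {𝔞 : Ideal (MvPowerSeries (Fin n) k)}

theorem pow (h : IsMonomialIdeal 𝔞) (N : ℕ) : IsMonomialIdeal (𝔞 ^ N) := by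
  obtain ⟨A, rfl⟩ := h
  exact ⟨N • A, span_monomial_pow A N⟩

theorem mem_exponents_of_coeff_ne_zero (h : IsMonomialIdeal 𝔞) {f : MvPowerSeries (Fin n) k}
    (hf : f ∈ 𝔞) {w : Fin n →₀ ℕ} (hw : MvPowerSeries.coeff w f ≠ 0) : w ∈ exponents 𝔞 := by
  obtain ⟨A, rfl⟩ := h
  obtain ⟨v, hv, hvw⟩ := exists_le_of_mem_span_monomial hf hw
  exact isUpperSet_exponents _ hvw (Ideal.subset_span ⟨v, hv, rfl⟩)

theorem exponents_pow (h : IsMonomialIdeal 𝔞) {N : ℕ} (hN : N ≠ 0) :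
    exponents (𝔞 ^ N) = N • exponents 𝔞 := by
  refine (nsmul_exponents_subset 𝔞 N).antisymm' fun w hw => ?_
  obtain ⟨A, rfl⟩ := h
  have hA : A ⊆ exponents (Ideal.span ((fun u => MvPowerSeries.monomial u (1 : k)) '' A)) :=
    fun u hu => Ideal.subset_span ⟨u, hu, rfl⟩
  rw [mem_exponents, span_monomial_pow] at hw
  obtain ⟨v, hv, hvw⟩ := exists_le_of_mem_span_monomial hw (w := w) (by simp)
  obtain ⟨N, rfl⟩ := Nat.exists_eq_succ_of_ne_zero hN
  rw [Nat.succ_eq_add_one, succ_nsmul] at hv ⊢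
  obtain ⟨a, ha, b, hb, rfl⟩ := hv
  refine ⟨a, Set.nsmul_subset_nsmul_left hA ha, b + (w - (a + b)),
    isUpperSet_exponents _ le_self_add (hA hb), ?_⟩
  change a + (b + (w - (a + b))) = w
  rw [← add_assoc, add_tsub_cancel_of_le hvw]

end IsMonomialIdeal

section Rounding

variable {ι : Type*} {U : Set (ι →₀ ℕ)}

theorem exponentVector_mem_smul_of_mem_nsmul {C : Set (ι → ℝ)} (hC : Convex ℝ C)
    (hU : exponentVector ι '' U ⊆ C) {N : ℕ} (hN : N ≠ 0) {w : ι →₀ ℕ} (hw : w ∈ N • U) :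
    exponentVector ι w ∈ (N : ℝ) • C := by
  induction N, Nat.one_le_iff_ne_zero.mpr hN using Nat.le_induction generalizing w with
  | base =>
    rw [one_nsmul] at hw
    simpa only [Nat.cast_one, one_smul] using hU ⟨w, hw, rfl⟩
  | succ N hN₁ ih =>
    rw [succ_nsmul] at hw
    obtain ⟨a, ha, b, hb, rfl⟩ := hw
    rw [Nat.cast_succ, hC.add_smul (Nat.cast_nonneg N) zero_le_one, one_smul, map_add]
    exact Set.add_mem_add (ih (Nat.one_le_iff_ne_zero.mp hN₁) ha) (hU ⟨b, hb, rfl⟩)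

theorem smul_mem_closedConvexHull_of_one_le (hU : IsUpperSet U) {c : ℝ} (hc : 1 ≤ c) {x : ι → ℝ}
    (hx : x ∈ closedConvexHull ℝ (exponentVector ι '' U)) :
    c • x ∈ closedConvexHull ℝ (exponentVector ι '' U) := by
  let P := closedConvexHull ℝ (exponentVector ι '' U)
  have hsub : exponentVector ι '' U ⊆ (fun y => c • y) ⁻¹' P := by
    rintro _ ⟨u, hu, rfl⟩
    have hu' : exponentVector ι u ∈ P := subset_closedConvexHull ⟨u, hu, rfl⟩
    have hmul : exponentVector ι (⌈c⌉₊ • u) ∈ P :=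
      subset_closedConvexHull ⟨_, hU (le_self_nsmul zero_le
        (Nat.ceil_pos.mpr (zero_lt_one.trans_le hc)).ne') hu, rfl⟩
    have hline : Convex ℝ {r : ℝ | r • exponentVector ι u ∈ P} :=
      convex_closedConvexHull.linear_preimage (LinearMap.toSpanSingleton ℝ _ (exponentVector ι u))
    refine hline.ordConnected.out (x := 1) (y := ⌈c⌉₊) ?_ ?_ ⟨hc, Nat.le_ceil c⟩
    · rwa [Set.mem_ofPred_eq, one_smul]
    · rwa [Set.mem_ofPred_eq, Nat.cast_smul_eq_nsmul, ← map_nsmul]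
  exact closedConvexHull_min hsub (convex_closedConvexHull.smul_preimage c)
    (isClosed_closedConvexHull.preimage (continuous_const_smul c)) hx

theorem smul_closedConvexHull_subset (hU : IsUpperSet U) {r s : ℝ} (hr : 0 < r) (hrs : r ≤ s) :
    s • closedConvexHull ℝ (exponentVector ι '' U) ⊆
      r • closedConvexHull ℝ (exponentVector ι '' U) := by
  rintro _ ⟨x, hx, rfl⟩
  refine ⟨(s / r) • x,
    smul_mem_closedConvexHull_of_one_le hU ((one_le_div hr).mpr hrs) hx, ?_⟩
  change r • (s / r) • x = s • x
  rw [smul_smul, mul_div_cancel₀ _ hr.ne']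

variable [Fintype ι]

theorem exists_mem_nsmul_le_smul_of_mem_convexHull {x : ι → ℝ}
    (hx : x ∈ convexHull ℝ (exponentVector ι '' U)) {M : ℝ} (hM : 0 ≤ M) :
    ∃ m : ℕ, ∃ v ∈ m • U, exponentVector ι v ≤ M • x ∧ M ≤ m + (Fintype.card ι + 1) := by
  obtain ⟨J, _, z, c, hz, hind, hc, hsum, rfl⟩ := eq_pos_convex_span_of_mem_convexHull hx
  have hcard : Fintype.card J ≤ Fintype.card ι + 1 := by
    simpa using hind.card_le_finrank_succ.trans (Nat.add_le_add_right (Submodule.finrank_le _) 1)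
  choose u hu hzu using fun j => hz ⟨j, rfl⟩
  refine ⟨∑ j, ⌊M * c j⌋₊, ∑ j, ⌊M * c j⌋₊ • u j, ?_, ?_, ?_⟩
  · rw [← Finset.sum_nsmul_assoc]
    exact Set.finsetSum_mem_finsetSum _ _ _ fun j _ => Set.nsmul_mem_nsmul (hu j)
  · rw [map_sum, Finset.smul_sum]
    refine Finset.sum_le_sum fun j _ i => ?_
    rw [map_nsmul, hzu, smul_smul, ← Nat.cast_smul_eq_nsmul ℝ]
    exact mul_le_mul_of_nonneg_right (Nat.floor_le (mul_nonneg hM (hc j).le))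
      (hzu j ▸ Nat.cast_nonneg _)
  · calc M = ∑ j, M * c j := by rw [← Finset.mul_sum, hsum, mul_one]
      _ ≤ ∑ j, ((⌊M * c j⌋₊ : ℝ) + 1) := Finset.sum_le_sum fun j _ => (Nat.lt_floor_add_one _).le
      _ = ((∑ j, ⌊M * c j⌋₊ : ℕ) : ℝ) + Fintype.card J := by
        simp [Finset.sum_add_distrib]
      _ ≤ _ := by gcongr; exact_mod_cast hcard

theorem exists_mem_nsmul_le_of_mem_smul_closedConvexHull {N : ℕ} {w : ι →₀ ℕ}
    (hw : exponentVector ι w ∈ ((N : ℝ) + (Fintype.card ι + 1)) •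
      closedConvexHull ℝ (exponentVector ι '' U)) :
    ∃ m ≥ N, ∃ v ∈ m • U, v ≤ w := by
  set M : ℝ := (N : ℝ) + (Fintype.card ι + 1)
  have hM : 0 < M := by positivity
  obtain ⟨x, hx, hxw⟩ := hw
  rw [closedConvexHull_eq_closure_convexHull] at hx
  obtain ⟨y, hy, hxy⟩ := Metric.mem_closure_iff.mp hx M⁻¹ (inv_pos.mpr hM)
  obtain ⟨m, v, hv, hvy, hm⟩ := exists_mem_nsmul_le_smul_of_mem_convexHull hy hM.le
  refine ⟨m, (Nat.cast_le (α := ℝ)).mp (le_of_add_le_add_right hm), v, hv,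
    fun i => Nat.lt_succ_iff.mp ?_⟩
  have hyx : y i - x i < M⁻¹ :=
    (le_abs_self _).trans_lt ((abs_sub_comm _ _).trans_lt ((dist_le_pi_dist x y i).trans_lt hxy))
  have hlt : (v i : ℝ) < (w i + 1 : ℕ) := calc
    (v i : ℝ) ≤ M * y i := hvy i
    _ < M * (x i + M⁻¹) := by gcongr; linarith
    _ = M * x i + 1 := by rw [mul_add, mul_inv_cancel₀ hM.ne']
    _ = (w i + 1 : ℕ) := by rw [Nat.cast_succ]; exact congrArg (· + 1) (congrFun hxw i)
  exact_mod_cast hlt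

end Rounding

section NewtonPolyhedron

variable {n : ℕ} {k : Type*} [Field k] {𝔞 : Ideal (MvPowerSeries (Fin n) k)}

theorem newtonPolyhedron_eq_closedConvexHull_exponents (𝔞 : Ideal (MvPowerSeries (Fin n) k)) :
    newtonPolyhedron 𝔞 = closedConvexHull ℝ (exponentVector (Fin n) '' exponents 𝔞) := by
  refine congrArg _ (Set.ext fun v => exists_congr fun u => and_congr_right fun _ => ?_)
  exact eq_comm

theorem smul_newtonPolyhedron_subset {r s : ℝ} (hr : 0 < r) (hrs : r ≤ s) :
    s • newtonPolyhedron 𝔞 ⊆ r • newtonPolyhedron 𝔞 := by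
  rw [newtonPolyhedron_eq_closedConvexHull_exponents]
  exact smul_closedConvexHull_subset (isUpperSet_exponents 𝔞) hr hrs

theorem IsMonomialIdeal.exponents_pow_subset (h𝔞 : IsMonomialIdeal 𝔞) {N : ℕ} (hN : N ≠ 0) :
    exponents (𝔞 ^ N) ⊆ exponentVector (Fin n) ⁻¹' ((N : ℝ) • newtonPolyhedron 𝔞) := by
  rw [h𝔞.exponents_pow hN, newtonPolyhedron_eq_closedConvexHull_exponents]
  exact fun w => exponentVector_mem_smul_of_mem_nsmul convex_closedConvexHull
    subset_closedConvexHull hN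

theorem preimage_smul_newtonPolyhedron_subset (𝔞 : Ideal (MvPowerSeries (Fin n) k)) (N : ℕ) :
    exponentVector (Fin n) ⁻¹' (((N : ℝ) + (n + 1)) • newtonPolyhedron 𝔞) ⊆
      exponents (𝔞 ^ N) := by
  intro w hw
  rw [newtonPolyhedron_eq_closedConvexHull_exponents] at hw
  obtain ⟨m, hm, v, hv, hvw⟩ :=
    exists_mem_nsmul_le_of_mem_smul_closedConvexHull (by rwa [Fintype.card_fin])
  exact isUpperSet_exponents _ hvw (Ideal.pow_le_pow_right hm (nsmul_exponents_subset 𝔞 m hv))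

theorem convex_newtonPolyhedron : Convex ℝ (newtonPolyhedron 𝔞) := convex_closedConvexHull

theorem isClosed_newtonPolyhedron : IsClosed (newtonPolyhedron 𝔞) := isClosed_closedConvexHull

theorem smul_smul_inter_Icc {ι : Type*} (P : Set (ι → ℝ)) (t : ℝ) {m : ℝ} (hm : 0 < m) :
    m • (t • P ∩ Set.Icc 0 1) = (t * m) • P ∩ Set.Icc 0 (m • 1) := by
  rw [Set.smul_set_inter₀ hm.ne', smul_smul, mul_comm]
  congr 1
  ext x
  rw [Set.mem_smul_set_iff_inv_smul_mem₀ hm.ne', Set.mem_Icc, Set.mem_Icc,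
    le_inv_smul_iff_of_pos hm, inv_smul_le_iff_of_pos hm, smul_zero]

theorem IsMonomialIdeal.tendsto_ncard_exponents_pow_div (h𝔞 : IsMonomialIdeal 𝔞) {t : ℝ}
    (ht : 0 < t) :
    Tendsto (fun m : ℕ => ((exponents (𝔞 ^ ⌈t * m⌉₊) ∩ exponentCube (Fin n) (m + 1)).ncard : ℝ) /
      ((m : ℝ) + 1) ^ n) atTop
      (𝓝 (volume.real (t • newtonPolyhedron 𝔞 ∩ Set.Icc (0 : Fin n → ℝ) 1))) := by
  have hclosed : IsClosed (t • newtonPolyhedron 𝔞 ∩ Set.Icc (0 : Fin n → ℝ) 1) :=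
    (isClosed_newtonPolyhedron.smul₀ t).inter isClosed_Icc
  have hconv : Convex ℝ (t • newtonPolyhedron 𝔞 ∩ Set.Icc (0 : Fin n → ℝ) 1) :=
    (convex_newtonPolyhedron.smul t).inter (convex_Icc 0 1)
  obtain ⟨d, hd⟩ := exists_nat_ge ((n + 2 : ℝ) / t)
  rw [div_le_iff₀ ht] at hd
  have h := tendsto_ncard_div_pow_of_lattice_points_subset Set.inter_subset_right
    hclosed.measurableSet (hconv.addHaar_frontier volume)
    (G := fun m => exponents (𝔞 ^ ⌈t * m⌉₊) ∩ exponentCube (Fin n) (m + 1)) d ?_ ?_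
  · simpa only [Fintype.card_fin] using h
  · rintro m hm w ⟨hw, hwm⟩
    have htm : 0 < t * m := by positivity
    rw [smul_smul_inter_Icc _ _ (Nat.cast_pos.mpr hm)]
    refine ⟨smul_newtonPolyhedron_subset htm (Nat.le_ceil _)
      (h𝔞.exponents_pow_subset (Nat.ceil_pos.mpr htm).ne' hw),
      fun i => Nat.cast_nonneg _, fun i => ?_⟩
    simpa using Nat.lt_succ_iff.mp (hwm i)
  · rintro m hm w ⟨hw, hwm⟩
    rw [Set.mem_preimage, smul_smul_inter_Icc _ _ (by positivity)] at hw
    refine ⟨preimage_smul_newtonPolyhedron_subset 𝔞 _ ?_, hwm⟩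
    refine smul_newtonPolyhedron_subset (by positivity) ?_ hw.1
    have := Nat.ceil_lt_add_one (a := t * m) (by positivity)
    push_cast
    linarith

end NewtonPolyhedron

section SplittingNumber

theorem card_le_of_dual_family {R M K ι κ : Type*} [CommRing R] [AddCommGroup M] [Module R M]
    [CommRing K] [Nontrivial K] [Finite ι] [Fintype κ] [DecidableEq κ] (ε : R →+* K)
    (B : Module.Basis ι R M) (s : Finset ι) {φ : κ → M →ₗ[R] R} {x : κ → M}
    (hφx : ∀ i j, φ i (x j) = if i = j then 1 else 0)
    (hs : ∀ i, ∀ b ∉ s, ε (φ i (B b)) = 0) : Fintype.card κ ≤ s.card := by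
  cases nonempty_fintype ι
  let A : Matrix κ s K := Matrix.of fun i b => ε (φ i (B b))
  let C : Matrix s κ K := Matrix.of fun b j => ε (B.repr (x j) b)
  have hAC : A * C = 1 := by
    ext i j
    calc (A * C) i j = ∑ b : s, ε (φ i (B b)) * ε (B.repr (x j) b) := rfl
      _ = ∑ b ∈ s, ε (φ i (B b)) * ε (B.repr (x j) b) :=
        Finset.sum_coe_sort s fun b => ε (φ i (B b)) * ε (B.repr (x j) b)
      _ = ∑ b, ε (φ i (B b)) * ε (B.repr (x j) b) :=
        Finset.sum_subset s.subset_univ fun b _ hb => by rw [hs i b hb, zero_mul]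
      _ = ε (φ i (∑ b, B.repr (x j) b • B b)) := by
        simp only [map_sum, map_smul, smul_eq_mul, map_mul, mul_comm]
      _ = (1 : Matrix κ κ K) i j := by
        rw [B.sum_repr, hφx, Matrix.one_apply, apply_ite ε, map_one, map_zero]
  calc Fintype.card κ = (A * C).rank := by rw [hAC, Matrix.rank_one]
    _ ≤ A.rank := Matrix.rank_mul_le_left A C
    _ ≤ Fintype.card s := A.rank_le_card_width
    _ = s.card := Fintype.card_coe s

variable {p : ℕ} [Fact p.Prime] {R : Type*} [CommRing R] [CharP R p] {e : ℕ}

theorem card_isDSummand_le {K ι : Type*} [CommRing K] [Nontrivial K] [Finite ι] (ε : R →+* K)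
    (B : Module.Basis ι R (FPush p e R)) (s : Finset ι) {De : AddSubgroup (CartierMap p R e)}
    (hs : ∀ φ ∈ De, ∀ i ∉ s, ε (φ (B i)) = 0) {m : ℕ} (M : Fin m → Submodule R (FPush p e R))
    (hM : DirectSum.IsInternal M) :
    Nat.card {j : Fin m // IsDSummand p De M hM j} ≤ s.card := by
  classical
  choose f hf using fun j : {j : Fin m // IsDSummand p De M hM j} => j.2
  rw [Nat.card_eq_fintype_card]
  refine card_le_of_dual_family ε B s (x := fun j => ((f j).symm 1 : M j)) (fun i j => ?_)
    fun j => hs _ (hf j)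
  split_ifs with h
  · subst h
    exact (congrArg (f i) (hM.ofBijective_coeLinearMap_same _)).trans ((f i).apply_symm_apply 1)
  · exact (congrArg (f i) (hM.ofBijective_coeLinearMap_of_ne
      (fun h' => h (Subtype.ext h'.symm)) _)).trans (map_zero _)

theorem isInternal_span_singleton {M ι : Type*} [AddCommGroup M] [Module R M] [DecidableEq ι]
    (B : Module.Basis ι R M) : DirectSum.IsInternal fun i => Submodule.span R {B i} :=
  DirectSum.isInternal_submodule_of_iSupIndep_of_iSup_eq_top
    B.linearIndependent.iSupIndep_span_singleton
    (by rw [← B.span_eq, Submodule.span_range_eq_iSup])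

theorem isDSummand_span_singleton {m : ℕ} (B : Module.Basis (Fin m) R (FPush p e R))
    {De : AddSubgroup (CartierMap p R e)} {i : Fin m} (hi : B.coord i ∈ De) :
    IsDSummand p De (fun j => Submodule.span R {B j}) (isInternal_span_singleton B) i := by
  have hmem (j : Fin m) : B j ∈ Submodule.span R {B j} := Submodule.mem_span_singleton_self _
  have hinj : Function.Injective (LinearMap.toSpanSingleton R _ (B i)) := fun a b h => by
    simpa using congrArg (B.coord i) h
  let f : (Submodule.span R {B i}) ≃ₗ[R] R := (LinearEquiv.ofInjective _ hinj ≪≫ₗ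
    LinearEquiv.ofEq _ _ (LinearMap.range_toSpanSingleton (B i))).symm
  have hf : f ⟨B i, hmem i⟩ = 1 := by
    rw [LinearEquiv.symm_apply_eq]
    exact Subtype.ext (one_smul R (B i)).symm
  refine ⟨f, ?_⟩
  convert hi
  refine B.ext fun j => ?_
  rw [Module.Basis.coord_apply, B.repr_self, Finsupp.single_apply]
  have hM := isInternal_span_singleton B
  split_ifs with h
  · subst h
    exact (congrArg f (hM.ofBijective_coeLinearMap_of_mem (hmem j))).trans hf
  · exact (congrArg f (hM.ofBijective_coeLinearMap_of_mem_ne h (hmem j))).trans (map_zero f)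

theorem splittingNumber_eq_card {K ι : Type*} [CommRing K] [Nontrivial K] [Finite ι] (ε : R →+* K)
    (B : Module.Basis ι R (FPush p e R)) (s : Finset ι) {De : AddSubgroup (CartierMap p R e)}
    (hs : ∀ φ ∈ De, ∀ i ∉ s, ε (φ (B i)) = 0) (hs' : ∀ i ∈ s, B.coord i ∈ De) :
    splittingNumber p De = s.card := by
  refine IsGreatest.csSup_eq ⟨?_, ?_⟩
  · let f := Finite.equivFin ι
    have hf (i : s) : IsDSummand p De _ (isInternal_span_singleton (B.reindex f)) (f i) :=
      isDSummand_span_singleton _ <| by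
        rw [show (B.reindex f).coord (f i) = B.coord i by ext; simp]
        exact hs' i i.2
    refine ⟨_, _, isInternal_span_singleton (B.reindex f),
      le_antisymm ?_ (card_isDSummand_le ε B s hs _ _)⟩
    simpa only [Nat.card_eq_fintype_card, Fintype.card_coe] using
      Nat.card_le_card_of_injective (fun i : s => Subtype.mk (f i) (hf i)) fun i j hij =>
        Subtype.ext (f.injective (congrArg Subtype.val hij))
  · rintro N ⟨m, M, hM, rfl⟩
    exact card_isDSummand_le ε B s hs M hM

end SplittingNumber

section PairCartier

variable {p : ℕ} [Fact p.Prime] {R : Type*} [CommRing R] [CharP R p]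

@[simp]
theorem FPush.mulMap_of (e : ℕ) (b x : R) : mulMap p e b (of p e R x) = of p e R (b * x) := rfl

theorem comp_mulMap_mem_cartierMulIdeal {e : ℕ} {I : Ideal R} (φ : CartierMap p R e) {b : R}
    (hb : b ∈ I) : φ ∘ₗ FPush.mulMap p e b ∈ cartierMulIdeal p e I :=
  AddSubgroup.subset_closure ⟨φ, b, hb, rfl⟩

/-- The product of the Cartier algebra as a biadditive map. -/
def cartierMulHom (e₁ e₂ : ℕ) :
    CartierMap p R e₁ →+ CartierMap p R e₂ →+ CartierMap p R (e₁ + e₂) :=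
  AddMonoidHom.mk' (fun φ => AddMonoidHom.mk' (cartierMul p φ) fun ψ ψ' =>
    LinearMap.ext fun x => map_add φ (FPush.of p e₁ R (ψ x)) (FPush.of p e₁ R (ψ' x)))
    fun _ _ => rfl

theorem cartierMul_comp_mulMap {e₁ e₂ : ℕ} (φ : CartierMap p R e₁) (ψ : CartierMap p R e₂)
    (b c : R) :
    cartierMul p (φ ∘ₗ FPush.mulMap p e₁ b) (ψ ∘ₗ FPush.mulMap p e₂ c) =
      cartierMul p φ ψ ∘ₗ FPush.mulMap p (e₁ + e₂) (b ^ p ^ e₂ * c) := by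
  ext x
  obtain ⟨x, rfl⟩ := (FPush.of p _ R).surjective x
  change φ (FPush.of p e₁ R (b * ψ (FPush.of p e₂ R (c * x)))) =
    φ (FPush.of p e₁ R (ψ (FPush.of p e₂ R (b ^ p ^ e₂ * c * x))))
  rw [mul_assoc, ← FPush.smul_of, map_smul, smul_eq_mul]

theorem cartierMul_mem_cartierMulIdeal {e₁ e₂ : ℕ} {I₁ I₂ I : Ideal R}
    (hI : ∀ b ∈ I₁, ∀ c ∈ I₂, b ^ p ^ e₂ * c ∈ I) {φ : CartierMap p R e₁} {ψ : CartierMap p R e₂}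
    (hφ : φ ∈ cartierMulIdeal p e₁ I₁) (hψ : ψ ∈ cartierMulIdeal p e₂ I₂) :
    cartierMul p φ ψ ∈ cartierMulIdeal p (e₁ + e₂) I := by
  have hgen (φ : CartierMap p R e₁) (b : R) (hb : b ∈ I₁) : cartierMulIdeal p e₂ I₂ ≤
      (cartierMulIdeal p (e₁ + e₂) I).comap (cartierMulHom e₁ e₂ (φ ∘ₗ FPush.mulMap p e₁ b)) := by
    refine (AddSubgroup.closure_le _).mpr ?_
    rintro _ ⟨ψ, c, hc, rfl⟩
    change cartierMul p _ _ ∈ cartierMulIdeal p (e₁ + e₂) I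
    rw [cartierMul_comp_mulMap]
    exact comp_mulMap_mem_cartierMulIdeal _ (hI b hb c hc)
  suffices h : cartierMulIdeal p e₁ I₁ ≤
      (cartierMulIdeal p (e₁ + e₂) I).comap ((cartierMulHom e₁ e₂).flip ψ) from h hφ
  refine (AddSubgroup.closure_le _).mpr ?_
  rintro _ ⟨φ, b, hb, rfl⟩
  exact hgen φ b hb hψ

theorem cartierMulIdeal_top (e : ℕ) : cartierMulIdeal p e (⊤ : Ideal R) = ⊤ := by
  refine eq_top_iff.mpr fun φ _ => ?_
  have hone : φ ∘ₗ FPush.mulMap p e (1 : R) = φ :=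
    LinearMap.ext fun x => congrArg φ (one_mul ((FPush.of p e R).symm x))
  exact hone ▸ comp_mulMap_mem_cartierMulIdeal φ Submodule.mem_top

theorem cartierMulIdeal_ne_bot {e : ℕ} [Module.Free R (FPush p e R)] {I : Ideal R} (hI : I ≠ ⊥) :
    cartierMulIdeal p e I ≠ ⊥ := by
  obtain ⟨b, hb, hb₀⟩ := Submodule.exists_mem_ne_zero_of_ne_bot hI
  let B := Module.Free.chooseBasis R (FPush p e R)
  intro hbot
  refine hb₀ ((FPush.of p e R).map_eq_zero_iff.mp (B.forall_coord_eq_zero_iff.mp fun i => ?_))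
  have hzero : B.coord i ∘ₗ FPush.mulMap p e b = 0 :=
    AddSubgroup.mem_bot.mp (hbot ▸ comp_mulMap_mem_cartierMulIdeal (B.coord i) hb)
  simpa using LinearMap.congr_fun hzero (FPush.of p e R 1)

theorem cartierMul_mem_pairCartier {𝔞 : Ideal R} {t : ℝ} {e₁ e₂ : ℕ} {φ : CartierMap p R e₁}
    {ψ : CartierMap p R e₂} (hφ : φ ∈ pairCartier p 𝔞 t e₁) (hψ : ψ ∈ pairCartier p 𝔞 t e₂) :
    cartierMul p φ ψ ∈ pairCartier p 𝔞 t (e₁ + e₂) := by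
  refine cartierMul_mem_cartierMulIdeal (fun b hb c hc => ?_) hφ hψ
  have hbc := Ideal.mul_mem_mul (Ideal.pow_mem_pow hb (p ^ e₂)) hc
  rw [← pow_mul, ← pow_add] at hbc
  refine Ideal.pow_le_pow_right (Nat.ceil_le.mpr ?_) hbc
  have h₁ := mul_le_mul_of_nonneg_right (Nat.le_ceil (t * ((p : ℝ) ^ e₁ - 1)))
    (pow_nonneg (Nat.cast_nonneg (α := ℝ) p) e₂)
  have h₂ := Nat.le_ceil (t * ((p : ℝ) ^ e₂ - 1))
  push_cast
  rw [pow_add]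
  linarith

theorem isCartierSubalgebra_pairCartier [NoZeroDivisors R] [Module.Free R (FPush p 1 R)]
    {𝔞 : Ideal R} (h𝔞 : 𝔞 ≠ ⊥) (t : ℝ) : IsCartierSubalgebra p (pairCartier p 𝔞 t) where
  zero_eq_top := by simp [pairCartier, cartierMulIdeal_top]
  mul_mem := cartierMul_mem_pairCartier
  exists_ne_bot := ⟨1, one_pos, cartierMulIdeal_ne_bot (pow_ne_zero _ h𝔞)⟩

end PairCartier

section DigitExponents

variable {σ : Type*} [Finite σ] {q : ℕ}

/-- The exponent `u` of a monomial `x^u` all of whose entries are less than `q`, encoded by a vector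
of digits in base `q`. -/
def digitExponent (u : σ → Fin q) : σ →₀ ℕ := Finsupp.equivFunOnFinite.symm fun i => (u i : ℕ)

@[simp]
theorem digitExponent_apply (u : σ → Fin q) (i : σ) : digitExponent u i = u i := rfl

theorem smul_add_digitExponent_inj {a b : σ →₀ ℕ} {u v : σ → Fin q} :
    q • a + digitExponent u = q • b + digitExponent v ↔ a = b ∧ u = v := by
  refine ⟨fun h => ?_, fun ⟨h, h'⟩ => by rw [h, h']⟩
  have hdiv (i : σ) : a i = b i ∧ (u i : ℕ) = v i := by
    have hi : u i + q * a i = v i + q * b i := by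
      simpa [add_comm] using DFunLike.congr_fun h i
    have hq : 0 < q := (u i).pos
    have hdigit (x : Fin q) (c : ℕ) : (x + q * c) / q = c ∧ (x + q * c) % q = x := by
      simp [Nat.add_mul_div_left _ _ hq, Nat.div_eq_of_lt x.isLt, Nat.mod_eq_of_lt x.isLt]
    exact ⟨(hdigit (u i) (a i)).1.symm.trans (hi ▸ (hdigit (v i) (b i)).1),
      (hdigit (u i) (a i)).2.symm.trans (hi ▸ (hdigit (v i) (b i)).2)⟩
  exact ⟨Finsupp.ext fun i => (hdiv i).1, funext fun i => Fin.ext (hdiv i).2⟩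

theorem exists_smul_add_digitExponent (hq : 0 < q) (d : σ →₀ ℕ) :
    ∃ (a : σ →₀ ℕ) (u : σ → Fin q), q • a + digitExponent u = d :=
  ⟨Finsupp.equivFunOnFinite.symm fun i => d i / q, fun i => ⟨d i % q, Nat.mod_lt _ hq⟩,
    Finsupp.ext fun i => by simp [Nat.div_add_mod]⟩

end DigitExponents

section MonomialBasis

variable {p : ℕ} [Fact p.Prime] {σ k : Type*} [CommRing k] [CharP k p] {e : ℕ}

theorem coeff_smul_pow (g : MvPowerSeries σ k) (d : σ →₀ ℕ) :
    MvPowerSeries.coeff (p ^ e • d) (g ^ p ^ e) = MvPowerSeries.coeff d g ^ p ^ e := by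
  have : ExpChar k p := ExpChar.prime Fact.out
  rw [← MvPowerSeries.map_iterateFrobenius_expand p (Fact.out : p.Prime).ne_zero,
    MvPowerSeries.coeff_map, MvPowerSeries.coeff_expand_smul, iterateFrobenius_def]

theorem exists_smul_eq_of_coeff_pow_ne_zero {g : MvPowerSeries σ k} {d : σ →₀ ℕ}
    (h : MvPowerSeries.coeff d (g ^ p ^ e) ≠ 0) : ∃ a : σ →₀ ℕ, p ^ e • a = d := by
  have : ExpChar k p := ExpChar.prime Fact.out
  have hdvd (i : σ) : p ^ e ∣ d i := by
    by_contra hi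
    rw [← MvPowerSeries.map_iterateFrobenius_expand p (Fact.out : p.Prime).ne_zero,
      MvPowerSeries.coeff_map, MvPowerSeries.coeff_expand_of_not_dvd _ _ _ hi, map_zero] at h
    exact h rfl
  exact ⟨d.mapRange (· / p ^ e) (Nat.zero_div _),
    Finsupp.ext fun i => by simp [Nat.mul_div_cancel' (hdvd i)]⟩

variable [Finite σ]

theorem coeff_pow_mul_monomial_self (g : MvPowerSeries σ k) (a : k) (d : σ →₀ ℕ)
    (u : σ → Fin (p ^ e)) :
    MvPowerSeries.coeff (p ^ e • d + digitExponent u)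
      (g ^ p ^ e * MvPowerSeries.monomial (digitExponent u) a) =
        MvPowerSeries.coeff d g ^ p ^ e * a := by
  rw [MvPowerSeries.coeff_add_mul_monomial, coeff_smul_pow]

theorem coeff_pow_mul_monomial_of_ne (g : MvPowerSeries σ k) (a : k) (d : σ →₀ ℕ)
    {u v : σ → Fin (p ^ e)} (huv : u ≠ v) :
    MvPowerSeries.coeff (p ^ e • d + digitExponent v)
      (g ^ p ^ e * MvPowerSeries.monomial (digitExponent u) a) = 0 := by
  classical
  rw [MvPowerSeries.coeff_mul_monomial]
  split_ifs with hle
  · by_contra hne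
    obtain ⟨b, hb⟩ := exists_smul_eq_of_coeff_pow_ne_zero (left_ne_zero_of_mul hne)
    refine huv (smul_add_digitExponent_inj (a := b) (b := d) |>.mp ?_).2
    rw [hb, tsub_add_cancel_of_le hle]
  · rfl

variable {J : Type*} (κ : Module.Basis J k (FPush p e k))

/-- The element `F^e_*(λ_j x^u)` of `F^e_* k⟦x⟧`, where `λ` is a basis of `F^e_* k`. -/
def digitMonomial (ju : J × (σ → Fin (p ^ e))) : FPush p e (MvPowerSeries σ k) :=
  FPush.of p e _ (MvPowerSeries.monomial (digitExponent ju.2) ((FPush.of p e k).symm (κ ju.1)))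

theorem coeff_sum_smul_digitMonomial [Fintype J] [Fintype (σ → Fin (p ^ e))]
    (c : J × (σ → Fin (p ^ e)) → MvPowerSeries σ k) (d : σ →₀ ℕ)
    (v : σ → Fin (p ^ e)) :
    FPush.of p e k (MvPowerSeries.coeff (p ^ e • d + digitExponent v)
      ((FPush.of p e _).symm (∑ ju, c ju • digitMonomial κ ju))) =
        κ.equivFun.symm fun j => MvPowerSeries.coeff d (c (j, v)) := by
  rw [map_sum, map_sum, map_sum, Fintype.sum_prod_type, κ.equivFun_symm_apply]
  refine Finset.sum_congr rfl fun j _ => ?_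
  simp only [digitMonomial, FPush.smul_of, AddEquiv.symm_apply_apply]
  rw [Finset.sum_eq_single v, coeff_pow_mul_monomial_self, ← FPush.smul_of,
    AddEquiv.apply_symm_apply]
  · intro u _ huv
    rw [coeff_pow_mul_monomial_of_ne _ _ _ huv, map_zero]
  · exact fun hv => absurd (Finset.mem_univ v) hv

variable [Finite J]

theorem linearIndependent_digitMonomial :
    LinearIndependent (MvPowerSeries σ k) (digitMonomial (σ := σ) κ) := by
  cases nonempty_fintype J
  cases nonempty_fintype (σ → Fin (p ^ e))
  refine Fintype.linearIndependent_iff.mpr fun c hc ⟨j, u⟩ => MvPowerSeries.ext fun d => ?_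
  have hzero := coeff_sum_smul_digitMonomial κ c d u
  rw [hc, map_zero, map_zero, map_zero, eq_comm, map_eq_zero_iff _ (LinearEquiv.injective _)]
    at hzero
  exact congrFun hzero j

theorem span_range_digitMonomial :
    Submodule.span (MvPowerSeries σ k) (Set.range (digitMonomial (σ := σ) κ)) = ⊤ := by
  cases nonempty_fintype J
  cases nonempty_fintype (σ → Fin (p ^ e))
  refine eq_top_iff.mpr fun f _ => ?_
  obtain ⟨f, rfl⟩ := (FPush.of p e _).surjective f
  let c (ju : J × (σ → Fin (p ^ e))) : MvPowerSeries σ k := fun d =>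
    κ.equivFun (FPush.of p e k (MvPowerSeries.coeff (p ^ e • d + digitExponent ju.2) f)) ju.1
  suffices h : (FPush.of p e _).symm (∑ ju, c ju • digitMonomial κ ju) = f by
    rw [← h, AddEquiv.apply_symm_apply]
    exact Submodule.sum_smul_mem _ _ fun ju _ => Submodule.subset_span ⟨ju, rfl⟩
  ext d
  obtain ⟨a, u, rfl⟩ := exists_smul_add_digitExponent (pow_pos (Fact.out : p.Prime).pos e) d
  apply (FPush.of p e k).injective
  rw [coeff_sum_smul_digitMonomial, LinearEquiv.symm_apply_eq]
  rfl

/-- The basis of `F^e_* k⟦x⟧` consisting of the elements `F^e_*(λ_j x^u)` with `0 ≤ u_i < p^e`. -/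
def monomialBasis : Module.Basis (J × (σ → Fin (p ^ e))) (MvPowerSeries σ k)
    (FPush p e (MvPowerSeries σ k)) :=
  Module.Basis.mk (linearIndependent_digitMonomial κ) (span_range_digitMonomial κ).ge

theorem monomialBasis_apply (j : J) (u : σ → Fin (p ^ e)) :
    monomialBasis κ (j, u) = FPush.of p e _
      (MvPowerSeries.monomial (digitExponent u) ((FPush.of p e k).symm (κ j))) := by
  rw [monomialBasis, Module.Basis.mk_apply, digitMonomial]

theorem coeff_monomialBasis_coord (f : MvPowerSeries σ k) (j : J) (u : σ → Fin (p ^ e))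
    (d : σ →₀ ℕ) :
    MvPowerSeries.coeff d ((monomialBasis κ).coord (j, u) (FPush.of p e _ f)) =
      κ.coord j (FPush.of p e k (MvPowerSeries.coeff (p ^ e • d + digitExponent u) f)) := by
  cases nonempty_fintype J
  cases nonempty_fintype (σ → Fin (p ^ e))
  have hsum : ∑ ju, (monomialBasis κ).coord ju (FPush.of p e _ f) • digitMonomial κ ju =
      FPush.of p e _ f := by
    simpa only [monomialBasis, Module.Basis.mk_apply, Module.Basis.coord_apply] using
      (monomialBasis κ).sum_repr (FPush.of p e _ f)
  have hcoeff := coeff_sum_smul_digitMonomial κ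
    (fun ju => (monomialBasis κ).coord ju (FPush.of p e _ f)) d u
  rw [hsum, AddEquiv.symm_apply_apply, LinearEquiv.eq_symm_apply] at hcoeff
  exact (congrFun hcoeff j).symm

theorem monomialBasis_coord_comp_mulMap_monomial (j : J) {u v : σ → Fin (p ^ e)} {w : σ →₀ ℕ}
    (h : w + digitExponent v = digitExponent u) :
    (monomialBasis κ).coord (j, u) ∘ₗ FPush.mulMap p e (MvPowerSeries.monomial w (1 : k)) =
      (monomialBasis κ).coord (j, v) := by
  ext f d
  obtain ⟨f, rfl⟩ := (FPush.of p e _).surjective f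
  rw [LinearMap.comp_apply, FPush.mulMap_of, coeff_monomialBasis_coord, coeff_monomialBasis_coord,
    ← h, add_left_comm, MvPowerSeries.coeff_add_monomial_mul, one_mul]

theorem constantCoeff_apply_eq_zero_of_coeff_digitExponent (κ : Module.Basis J k (FPush p e k))
    (φ : CartierMap p (MvPowerSeries σ k) e) {f : MvPowerSeries σ k}
    (hf : ∀ v : σ → Fin (p ^ e), MvPowerSeries.coeff (digitExponent v) f = 0) :
    MvPowerSeries.constantCoeff (φ (FPush.of p e _ f)) = 0 := by
  cases nonempty_fintype J
  cases nonempty_fintype (σ → Fin (p ^ e))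
  rw [← (monomialBasis κ).sum_repr (FPush.of p e _ f), map_sum, map_sum]
  refine Finset.sum_eq_zero fun ⟨j, v⟩ _ => ?_
  rw [map_smul, smul_eq_mul, map_mul, ← Module.Basis.coord_apply,
    ← MvPowerSeries.coeff_zero_eq_constantCoeff_apply, coeff_monomialBasis_coord, smul_zero,
    zero_add, hf, map_zero, map_zero, zero_mul]

end MonomialBasis

section MonomialSplitting

variable {p : ℕ} [Fact p.Prime] {k : Type*} [Field k] [CharP k p] {e n : ℕ} {J : Type*}
  (κ : Module.Basis J k (FPush p e k)) {I : Ideal (MvPowerSeries (Fin n) k)}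

theorem rev_mem_exponents_of_coeff_mul_monomial_ne_zero (hI : IsMonomialIdeal I) {q : ℕ}
    {b : MvPowerSeries (Fin n) k} (hb : b ∈ I) {a : k} {u v : Fin n → Fin q}
    (h : MvPowerSeries.coeff (digitExponent v)
      (b * MvPowerSeries.monomial (digitExponent u) a) ≠ 0) :
    digitExponent (Fin.rev ∘ u) ∈ exponents I := by
  rw [MvPowerSeries.coeff_mul_monomial] at h
  have hmem := hI.mem_exponents_of_coeff_ne_zero hb (left_ne_zero_of_mul (ite_ne_right_iff.mp h).2)
  refine isUpperSet_exponents I (fun i => ?_) hmem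
  have := (v i).isLt
  simp only [Finsupp.tsub_apply, digitExponent_apply, Function.comp_apply, Fin.val_rev]
  lia

variable [Finite J]

theorem constantCoeff_apply_monomialBasis_eq_zero (hI : IsMonomialIdeal I)
    {φ : CartierMap p (MvPowerSeries (Fin n) k) e} (hφ : φ ∈ cartierMulIdeal p e I) (j : J)
    {u : Fin n → Fin (p ^ e)} (hu : digitExponent (Fin.rev ∘ u) ∉ exponents I) :
    MvPowerSeries.constantCoeff (φ (monomialBasis κ (j, u))) = 0 := by
  induction hφ using AddSubgroup.closure_induction with
  | mem φ h =>
    obtain ⟨φ, b, hb, rfl⟩ := h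
    rw [monomialBasis_apply, LinearMap.comp_apply, FPush.mulMap_of]
    refine constantCoeff_apply_eq_zero_of_coeff_digitExponent κ φ fun v => ?_
    by_contra h
    exact hu (rev_mem_exponents_of_coeff_mul_monomial_ne_zero hI hb h)
  | zero => rw [LinearMap.zero_apply, map_zero]
  | add φ ψ _ _ h h' => rw [LinearMap.add_apply, map_add, h, h', add_zero]
  | neg φ _ h => rw [LinearMap.neg_apply, map_neg, h, neg_zero]

theorem monomialBasis_coord_mem_cartierMulIdeal (j : J) {u : Fin n → Fin (p ^ e)}
    (hu : digitExponent (Fin.rev ∘ u) ∈ exponents I) :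
    (monomialBasis κ).coord (j, u) ∈ cartierMulIdeal p e I := by
  have hq : 0 < p ^ e := pow_pos (Fact.out : p.Prime).pos e
  rw [← monomialBasis_coord_comp_mulMap_monomial κ j (u := fun _ => ⟨p ^ e - 1, by lia⟩)
    (w := digitExponent (Fin.rev ∘ u))]
  · exact comp_mulMap_mem_cartierMulIdeal _ hu
  · ext i
    have := (u i).isLt
    simp only [Finsupp.add_apply, digitExponent_apply, Function.comp_apply, Fin.val_rev]
    lia

theorem image_digitExponent_rev (q : ℕ) (E : Set (Fin n →₀ ℕ)) :
    (fun u : Fin n → Fin q => digitExponent (Fin.rev ∘ u)) ''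
      {u | digitExponent (Fin.rev ∘ u) ∈ E} = E ∩ exponentCube (Fin n) q := by
  ext w
  constructor
  · rintro ⟨u, hu, rfl⟩
    exact ⟨hu, fun i => (u i).rev.isLt⟩
  · rintro ⟨hw, hlt⟩
    have heq : digitExponent (Fin.rev ∘ fun i => Fin.rev ⟨w i, hlt i⟩) = w :=
      Finsupp.ext fun i => by simp
    refine ⟨fun i => Fin.rev ⟨w i, hlt i⟩, ?_, heq⟩
    rwa [Set.mem_ofPred_eq, heq]

theorem ncard_rev_mem (q : ℕ) (E : Set (Fin n →₀ ℕ)) :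
    {u : Fin n → Fin q | digitExponent (Fin.rev ∘ u) ∈ E}.ncard =
      (E ∩ exponentCube (Fin n) q).ncard := by
  rw [← image_digitExponent_rev, Set.ncard_image_of_injective]
  intro u v huv
  exact funext fun i => Fin.rev_injective (Fin.ext (DFunLike.congr_fun huv i))

theorem splittingNumber_cartierMulIdeal [Module.Finite k (FPush p e k)] (hI : IsMonomialIdeal I) :
    splittingNumber p (cartierMulIdeal p e I) =
      Module.finrank k (FPush p e k) * (exponents I ∩ exponentCube (Fin n) (p ^ e)).ncard := by
  classical
  let κ := Module.finBasis k (FPush p e k)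
  let s : Finset (Fin n → Fin (p ^ e)) := {u | digitExponent (Fin.rev ∘ u) ∈ exponents I}
  have hmem {u} : u ∈ s ↔ digitExponent (Fin.rev ∘ u) ∈ exponents I := by simp [s]
  have hcard : s.card = (exponents I ∩ exponentCube (Fin n) (p ^ e)).ncard := by
    rw [← ncard_rev_mem, ← Set.ncard_coe_finset]
    simp [s]
  rw [splittingNumber_eq_card MvPowerSeries.constantCoeff (monomialBasis κ) (Finset.univ ×ˢ s),
    Finset.card_product, Finset.card_univ, Fintype.card_fin, hcard]
  · rintro φ hφ ⟨j, u⟩ hju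
    exact constantCoeff_apply_monomialBasis_eq_zero κ hI hφ j fun hu =>
      hju (Finset.mk_mem_product (Finset.mem_univ j) (hmem.mpr hu))
  · rintro ⟨j, u⟩ hju
    exact monomialBasis_coord_mem_cartierMulIdeal κ j (hmem.mp (Finset.mem_product.mp hju).2)

end MonomialSplitting

section KrullDimension

theorem ringKrullDim_powerSeries (R : Type*) [CommRing R] [IsNoetherianRing R] :
    ringKrullDim (PowerSeries R) = ringKrullDim R + 1 := by
  have hker : Ideal.span {(PowerSeries.X : PowerSeries R)} =
      RingHom.ker (PowerSeries.constantCoeff (R := R)) := by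
    ext f
    rw [RingHom.mem_ker, Ideal.mem_span_singleton, PowerSeries.X_dvd_iff]
  have hX : (PowerSeries.X : PowerSeries R) ∈ nonZeroDivisors (PowerSeries R) :=
    MvPowerSeries.X_mem_nonzeroDivisors
  have hjac : (PowerSeries.X : PowerSeries R) ∈ Ring.jacobson (PowerSeries R) := by
    rw [← Ideal.jacobson_bot, Ideal.mem_jacobson_bot]
    intro f
    rw [PowerSeries.isUnit_iff_constantCoeff]
    simp
  rw [← ringKrullDim_quotient_span_singleton_succ_eq_ringKrullDim_of_mem_jacobson
    (Module.Flat.isSMulRegular_of_nonZeroDivisors hX) hjac,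
    ringKrullDim_eq_of_ringEquiv ((Ideal.quotEquivOfEq hker).trans
      (RingHom.quotientKerEquivOfSurjective PowerSeries.constantCoeff_surj))]

theorem ringKrullDim_mvPowerSeries_fin (R : Type*) [CommRing R] [IsNoetherianRing R] (n : ℕ) :
    ringKrullDim (MvPowerSeries (Fin n) R) = ringKrullDim R + n := by
  induction n with
  | zero =>
    rw [ringKrullDim_eq_of_ringEquiv (MvPowerSeries.isEmptyEquiv (Fin 0) R).toRingEquiv,
      Nat.cast_zero, add_zero]
  | succ n ih =>
    rw [ringKrullDim_eq_of_ringEquiv (MvPowerSeries.finSuccEquiv R n).toRingEquiv,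
      ringKrullDim_powerSeries, ih, Nat.cast_succ, add_assoc]

theorem krullDimNat_mvPowerSeries (k : Type*) [Field k] (n : ℕ) :
    krullDimNat (MvPowerSeries (Fin n) k) = n := by
  rw [krullDimNat, ringKrullDim_mvPowerSeries_fin, ringKrullDim_eq_zero_of_field, zero_add]
  rfl

end KrullDimension

section FrobeniusDegree

variable {p : ℕ} [Fact p.Prime]

theorem FPush.of_symm_smul {R : Type*} [CommRing R] [CharP R p] (e : ℕ) (r : R) (x : FPush p e R) :
    (FPush.of p e R).symm (r • x) = r ^ p ^ e * (FPush.of p e R).symm x := rfl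

/-- A basis of `F_* R` identifies `F^{e+1}_* R` with a finite power of `F^e_* R`. -/
def FPush.piEquiv {R ι : Type*} [CommRing R] [CharP R p] [Finite ι]
    (b : Module.Basis ι R (FPush p 1 R)) (e : ℕ) :
    (ι → FPush p e R) ≃ₗ[R] FPush p (e + 1) R :=
  AddEquiv.toLinearEquiv
    ((AddEquiv.piCongrRight fun _ => (FPush.of p e R).symm).trans
      (b.equivFun.symm.toAddEquiv.trans ((FPush.of p 1 R).symm.trans (FPush.of p (e + 1) R))))
    fun r g => by
      have hsmul := map_smul b.equivFun.symm (r ^ p ^ e) fun i => (FPush.of p e R).symm (g i)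
      change FPush.of p (e + 1) R ((FPush.of p 1 R).symm
        (b.equivFun.symm (r ^ p ^ e • fun i => (FPush.of p e R).symm (g i)))) =
          FPush.of p (e + 1) R (r ^ p ^ (e + 1) * (FPush.of p 1 R).symm _)
      rw [hsmul, FPush.of_symm_smul, ← pow_mul, ← pow_add]
      rfl

theorem FPush.nonempty_basis {R ι : Type*} [CommRing R] [CharP R p] [Finite ι]
    (b : Module.Basis ι R (FPush p 1 R)) (e : ℕ) :
    Nonempty (Module.Basis (Fin e → ι) R (FPush p e R)) := by
  induction e with
  | zero =>
    exact ⟨(Module.Basis.singleton (Fin 0 → ι) R).map <|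
      AddEquiv.toLinearEquiv (FPush.of p 0 R) fun r x => by rw [FPush.smul_of]; simp⟩
  | succ e ih =>
    obtain ⟨B⟩ := ih
    cases nonempty_fintype ι
    exact ⟨((Pi.basis fun _ : ι => B).map (FPush.piEquiv b e)).reindex
      ((Equiv.sigmaEquivProd ι (Fin e → ι)).trans (Fin.consEquiv fun _ => ι))⟩

variable {k : Type*} [Field k] [CharP k p]

theorem IsFFinite.finite_FPush (hk : IsFFinite p k) (e : ℕ) : Module.Finite k (FPush p e k) := by
  have : Module.Finite k (FPush p 1 k) := hk
  obtain ⟨B⟩ := FPush.nonempty_basis (Module.finBasis k (FPush p 1 k)) e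
  exact Module.Finite.of_basis B

theorem IsFFinite.finrank_FPush (hk : IsFFinite p k) (e : ℕ) :
    Module.finrank k (FPush p e k) = Module.finrank k (FPush p 1 k) ^ e := by
  have : Module.Finite k (FPush p 1 k) := hk
  obtain ⟨B⟩ := FPush.nonempty_basis (Module.finBasis k (FPush p 1 k)) e
  rw [Module.finrank_eq_card_basis B, Fintype.card_fun, Fintype.card_fin, Fintype.card_fin]

theorem IsFFinite.finrank_FPush_pos (hk : IsFFinite p k) (e : ℕ) :
    0 < Module.finrank k (FPush p e k) := by
  have : Nontrivial (FPush p e k) := inferInstanceAs (Nontrivial k)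
  have := hk.finite_FPush e
  exact Module.finrank_pos

/-- The residue field of `k⟦x⟧` is `k`. -/
def residueFieldMvPowerSeriesEquiv (σ k : Type*) [Field k] :
    IsLocalRing.ResidueField (MvPowerSeries σ k) ≃+* k :=
  have hsurj : Function.Surjective (MvPowerSeries.constantCoeff (σ := σ) (R := k)) :=
    fun a => ⟨MvPowerSeries.C a, MvPowerSeries.constantCoeff_C a⟩
  (Ideal.quotEquivOfEq (IsLocalRing.ker_eq_maximalIdeal _ hsurj).symm).trans
    (RingHom.quotientKerEquivOfSurjective hsurj)

theorem finrank_frobenius_fieldRange {K : Type*} [Field K] [CharP K p] (ρ : K ≃+* k) :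
    Module.finrank (frobenius K p).fieldRange K = Module.finrank k (FPush p 1 k) := by
  let i : k → (frobenius K p).fieldRange := (frobenius K p).rangeRestrictField ∘ ρ.symm
  let j : FPush p 1 k ≃+ K := (FPush.of p 1 k).symm.trans ρ.symm.toAddEquiv
  have hi : Function.Bijective i := Function.Bijective.comp
    ⟨(frobenius K p).rangeRestrictField.injective,
      (frobenius K p).rangeRestrictField_bijective.surjective⟩ ρ.symm.bijective
  have hj (r : k) (x : FPush p 1 k) : j (r • x) = i r • j x := by
    obtain ⟨x, rfl⟩ := (FPush.of p 1 k).surjective x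
    rw [FPush.smul_of, Subfield.smul_def]
    simp [i, j, frobenius_def]
  have hrank := congrArg Cardinal.toNat (lift_rank_eq_of_equiv_equiv i j hi hj)
  rw [Cardinal.toNat_lift, Cardinal.toNat_lift] at hrank
  exact hrank.symm

theorem IsFFinite.rpow_mul_krullDimNat_add_alphaInv (hk : IsFFinite p k) (n e : ℕ) :
    (p : ℝ) ^ ((e : ℝ) * ((krullDimNat (MvPowerSeries (Fin n) k) : ℝ) +
      alphaInv p (MvPowerSeries (Fin n) k))) =
      ((p : ℝ) ^ e) ^ n * Module.finrank k (FPush p e k) := by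
  have hp : 1 < (p : ℝ) := by exact_mod_cast (Fact.out : p.Prime).one_lt
  have hd : (0 : ℝ) < Module.finrank k (FPush p 1 k) := by
    exact_mod_cast hk.finrank_FPush_pos 1
  rw [krullDimNat_mvPowerSeries, alphaInv,
    finrank_frobenius_fieldRange (residueFieldMvPowerSeriesEquiv (Fin n) k), hk.finrank_FPush e,
    mul_comm, Real.rpow_mul (by positivity), Real.rpow_add (by positivity),
    Real.rpow_logb (by positivity) hp.ne' hd]
  norm_cast
  rw [mul_pow, pow_right_comm]

end FrobeniusDegree

theorem HasFSignature.of_tendsto {p : ℕ} [Fact p.Prime] {R : Type*} [CommRing R] [CharP R p]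
    [IsLocalRing R] {D : ∀ e, AddSubgroup (CartierMap p R e)} {s : ℝ}
    (h : Tendsto (fun e : ℕ => (splittingNumber p (D e) : ℝ) /
      (p : ℝ) ^ ((e : ℝ) * ((krullDimNat R : ℝ) + alphaInv p R))) atTop (𝓝 s)) :
    HasFSignature p D s where
  tendsto := h.mono_left inf_le_left
  eq_zero_of_finite hfin := by
    refine tendsto_nhds_unique h (tendsto_const_nhds.congr' ?_)
    rw [← Nat.cofinite_eq_atTop]
    filter_upwards [hfin.compl_mem_cofinite] with e he
    rw [show splittingNumber p (D e) = 0 from not_not.mp he, Nat.cast_zero, zero_div]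

theorem splittingNumber_pairCartier_div {p : ℕ} [Fact p.Prime] {k : Type*} [Field k] [CharP k p]
    (hk : IsFFinite p k) {n : ℕ} {𝔞 : Ideal (MvPowerSeries (Fin n) k)} (h𝔞 : IsMonomialIdeal 𝔞)
    (t : ℝ) (e : ℕ) :
    (splittingNumber p (pairCartier p 𝔞 t e) : ℝ) /
      (p : ℝ) ^ ((e : ℝ) * ((krullDimNat (MvPowerSeries (Fin n) k) : ℝ) +
        alphaInv p (MvPowerSeries (Fin n) k))) =
      ((exponents (𝔞 ^ ⌈t * ((p : ℝ) ^ e - 1)⌉₊) ∩ exponentCube (Fin n) (p ^ e)).ncard : ℝ) /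
        ((p : ℝ) ^ e) ^ n := by
  have := hk.finite_FPush e
  have hd : (Module.finrank k (FPush p e k) : ℝ) ≠ 0 := by
    exact_mod_cast (hk.finrank_FPush_pos e).ne'
  rw [hk.rpow_mul_krullDimNat_add_alphaInv, pairCartier,
    splittingNumber_cartierMulIdeal (h𝔞.pow _), Nat.cast_mul, mul_comm, mul_div_mul_right _ _ hd]

end

theorem theorem4p17 (p : ℕ) [Fact p.Prime] (k : Type*) [Field k] [CharP k p]
    (hk : IsFFinite p k) (n : ℕ) (𝔞 : Ideal (MvPowerSeries (Fin n) k))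
    (h𝔞 : IsMonomialIdeal 𝔞) (t : ℝ) (ht : 0 < t) :
    (𝔞 ≠ ⊥ → IsCartierSubalgebra p (pairCartier p 𝔞 t)) ∧
      HasFSignature p (pairCartier p 𝔞 t)
        (volume.real (t • newtonPolyhedron 𝔞 ∩ Set.Icc (0 : Fin n → ℝ) 1)) := by
  refine ⟨fun hne => ?_, .of_tendsto ?_⟩
  · have : Module.Finite k (FPush p 1 k) := hk
    have := Module.Free.of_basis
      (monomialBasis (σ := Fin n) (Module.finBasis k (FPush p 1 k)))
    exact isCartierSubalgebra_pairCartier hne t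
  · have hp : 1 < p := (Fact.out : p.Prime).one_lt
    have hpred : Tendsto (fun e : ℕ => p ^ e - 1) atTop atTop :=
      (tendsto_sub_atTop_nat 1).comp (tendsto_pow_atTop_atTop_of_one_lt hp)
    refine ((h𝔞.tendsto_ncard_exponents_pow_div ht).comp hpred).congr fun e => ?_
    have hpe : 1 ≤ p ^ e := Nat.one_le_pow _ _ hp.pos
    rw [splittingNumber_pairCartier_div hk h𝔞, Function.comp_apply, Nat.sub_add_cancel hpe]
    push_cast [hpe]
    rw [sub_add_cancel]
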